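/- Let claims arrive according to a Poisson process $N$ with rate $\lambda>0$, let premiums flow in at rate $1$, and let $\epsilon\in(0,1]$. Let $B\ge 0$ have a phase-type distribution with $\mathbb{E}B>0$, and let $C\ge 0$ have finite mean $\mathbb{E}C>0$; a claim size of the mixture model is distributed as $B$ with probability $1-\epsilon$ and as $C$ with probability $\epsilon$. Put $\delta=\lambda\mathbb{E}B$ and $\theta=\lambda\mathbb{E}C$, and assume $\delta<1$. For a nonnegative random variable $X$ with $0<\mathbb{E}X<\infty$ let $X^e$ be a random variable with the stationary excess distribution $\mathbb{P}(X^e\le u)=\frac{1}{\mathbb{E}X}\int_0^u\mathbb{P}(X>t)\,dt$. Let $M=\sup_{t\ge 0}\big(\sum_{i=1}^{N(t)}B_i-t\big)$ be the supremum of the claim surplus process of the base model obtained by replacing the heavy-tailed claims with phase-type ones (i.e. $\epsilon=0$), where $B_1,B_2,\dots$ are i.i.d. copies of $B$ independent of $N$, and let $\psi_0(u)=\mathbb{P}(M>u)$. Let $M_0,M_1$ be copies of $M$, with $M_0,M_1,B^e,C^e$ independent. The corrected replace approximation is \[ \hat\psi_{r,\epsilon}(u)=\psi_0(u)+\frac{\epsilon\theta}{1-\delta}\Big(\mathbb{P}(M_0+M_1+C^e>u)-\mathbb{P}(M_0>u)\Big)-\frac{\epsilon\delta}{1-\delta}\Big(\mathbb{P}(M_0+M_1+B^e>u)-\mathbb{P}(M_0>u)\Big).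 \] If the distribution $F$ of $C^e$ is subexponential, i.e. $\lim_{u\to\infty}\frac{1-F^{*n}(u)}{1-F(u)}=n$ for all $n\ge 1$, then \[ \hat\psi_{r,\epsilon}(u)\sim\frac{\epsilon\theta}{1-\delta}\,\mathbb{P}(C^e>u)\qquad\text{as }u\to\infty, \] that is, the ratio of the two sides tends to $1$. -/

import Mathlib

open MeasureTheory ProbabilityTheory Filter Topology Set
open scoped NNReal

noncomputable section

/-! ### Phase-type distributions -/

/-- `Q` is the generator (intensity matrix) of a Markov jump process on the finite set `E`. -/
def IsGenerator {E : Type*} [Fintype E] (Q : Matrix E E ℝ) : Prop :=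
  (∀ i j, i ≠ j → 0 ≤ Q i j) ∧ ∀ i, ∑ j, Q i j = 0

/-- The matrix of transition probabilities over a time span of length `t` of the Markov jump
process with generator `Q`. -/
def transitionMatrix {E : Type*} [Fintype E] [DecidableEq E] (Q : Matrix E E ℝ) (t : ℝ) :
    Matrix E E ℝ :=
  NormedSpace.exp (t • Q)

/-- `μ` is phase-type: it is the law of the time until absorption of a Markov jump process with
finitely many transient states `some i` and one absorbing state `none`, started from the
probability vector `α`.  The absorption time is at most `t` iff the process is in the
absorbing state at time `t`. -/
def IsPhaseType (μ : Measure ℝ) : Prop :=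
  IsProbabilityMeasure μ ∧ μ (Iio 0) = 0 ∧
  ∃ (n : ℕ) (α : Option (Fin n) → ℝ) (Q : Matrix (Option (Fin n)) (Option (Fin n)) ℝ),
    (∀ i, 0 ≤ α i) ∧ ∑ i, α i = 1 ∧
    IsGenerator Q ∧
    -- the state `none` is absorbing
    (∀ j, Q none j = 0) ∧
    -- all other states are transient: absorption is certain from every state
    (∀ i, Tendsto (fun t : ℝ => transitionMatrix Q t i none) atTop (𝓝 1)) ∧
    ∀ t : ℝ, 0 ≤ t → μ.real (Iic t) = ∑ i, α i * transitionMatrix Q t i none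

/-! ### Stationary excess distributions and subexponential distributions -/

/-- The mean of a distribution on the real line. -/
def mean (μ : Measure ℝ) : ℝ := ∫ x, x ∂μ

/-- The stationary excess distribution of a distribution `μ` on `[0, ∞)` with finite positive
mean: its density at `t ≥ 0` is `μ (t, ∞) / mean μ`. -/
def stationaryExcess (μ : Measure ℝ) : Measure ℝ :=
  (volume.restrict (Ici (0 : ℝ))).withDensity
    (fun t => ENNReal.ofReal (μ.real (Ioi t) / mean μ))

/-- The `n`-fold convolution of `F` with itself. -/
def convPow (F : Measure ℝ) : ℕ → Measure ℝ
  | 0 => Measure.dirac 0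
  | n + 1 => Measure.conv (convPow F n) F

/-- `F` belongs to the class of subexponential distributions. -/
def IsSubexponential (F : Measure ℝ) : Prop :=
  IsProbabilityMeasure F ∧ F (Iio 0) = 0 ∧
  ∀ n : ℕ, 1 ≤ n →
    Tendsto (fun u : ℝ => (convPow F n).real (Ioi u) / F.real (Ioi u)) atTop (𝓝 (n : ℝ))

/-! ### The classical risk model -/

/-- `N` is a Poisson process with rate `lam`. -/
structure IsPoissonProcess {Ω : Type*} [MeasurableSpace Ω] (P : Measure Ω) (lam : ℝ≥0)
    (N : ℝ≥0 → Ω → ℕ) : Prop where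
  measurable : ∀ t, Measurable (N t)
  zero : ∀ ω, N 0 ω = 0
  mono : ∀ ω, Monotone (fun t => N t ω)
  rightCts : ∀ ω t, ContinuousWithinAt (fun s => N s ω) (Ioi t) t
  indepIncrements : HasIndepIncrements N P
  law_increment : ∀ s t, s ≤ t →
    HasLaw (fun ω => N t ω - N s ω) (poissonMeasure (lam * (t - s))) P

/-- The compound Poisson claim model: claims arrive according to the Poisson process `N` with
rate `lam`; the claim sizes `U 0, U 1, …` are i.i.d. with law `G` and independent of `N`. -/
structure IsClaimModel {Ω : Type*} [MeasurableSpace Ω] (P : Measure Ω) (lam : ℝ≥0)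
    (G : Measure ℝ) (N : ℝ≥0 → Ω → ℕ) (U : ℕ → Ω → ℝ) : Prop where
  poisson : IsPoissonProcess P lam N
  claim_measurable : ∀ i, Measurable (U i)
  claim_law : ∀ i, HasLaw (U i) G P
  claim_indep : iIndepFun U P
  indep : IndepFun (fun ω t => N t ω) (fun ω i => U i ω) P

/-- The claim surplus at time `t`, for premium rate `1`: claims received up to time `t`
minus premiums. -/
def claimSurplus {Ω : Type*} (N : ℝ≥0 → Ω → ℕ) (U : ℕ → Ω → ℝ) (t : ℝ≥0) (ω : Ω) : ℝ :=
  ∑ i ∈ Finset.range (N t ω), U i ω - (t : ℝ)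

/-- The supremum over all times of the claim surplus process. -/
def surplusSup {Ω : Type*} (N : ℝ≥0 → Ω → ℕ) (U : ℕ → Ω → ℝ) (ω : Ω) : EReal :=
  ⨆ t : ℝ≥0, (claimSurplus N U t ω : EReal)

/-! ### The corrected replace approximation -/

/-- `P (M₀ + M₁ + X > u)` for independent `M₀`, `M₁` with law `ν` and `X` with law `μ`. -/
def tailSum (ν : Measure EReal) (μ : Measure ℝ) (u : ℝ) : ℝ :=
  (ν.prod (ν.prod μ)).real {x | (u : EReal) < x.1 + x.2.1 + (x.2.2 : EReal)}

/-- The corrected replace approximation at initial capital `u`. Here `lam` is the arrival rate,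
`eps` the perturbation parameter, `B` and `C` are the laws of the phase-type and the heavy-tailed
claim sizes, and `ν` is the law of the supremum of the claim surplus process in the model in
which all claim sizes have law `B`. -/
def correctedReplace (lam : ℝ≥0) (eps : ℝ) (B C : Measure ℝ) (ν : Measure EReal) (u : ℝ) : ℝ :=
  let δ : ℝ := lam * mean B
  let θ : ℝ := lam * mean C
  let ψ : ℝ := ν.real (Ioi (u : EReal))
  ψ + eps * θ / (1 - δ) * (tailSum ν (stationaryExcess C) u - ψ)
    - eps * δ / (1 - δ) * (tailSum ν (stationaryExcess B) u - ψ)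

end

/-!
Subexponential tails are heavier than every exponential, whereas everything of phase-type in the
approximation has an exponential moment. So `ψ₀(u)` and `P(M₀ + M₁ + Bᵉ > u)` are negligible
compared with `P(Cᵉ > u)`, while adding the light-tailed `M₀ + M₁` to the independent `Cᵉ` does not
change the asymptotics of its tail: `P(M₀ + M₁ + Cᵉ > u) ∼ P(Cᵉ > u)`. Only the coefficient
`εθ / (1 - δ)` of the latter term survives.

*Light tails.* From every state of a phase-type generator absorption by some time `T` has
probability at least `1 / 2`, so the survival probability halves over each period of length `T`
(`survival_add_le`) and a small exponential moment is finite
(`IsPhaseType.exists_integrable_exp`). As `δ < 1`, some `κ > 0` satisfies the Lundberg inequality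
`λ (E e^(κB) - 1) < κ` (`exists_lundberg_exponent`). Then `E e^(κ S_k)` decays geometrically in `k`
for the claim surplus `S`. Between consecutive integers `S` exceeds its next integer value by at
most `1`, so a union bound over integer times gives `E e^(κM) < ∞` without any maximal inequality
(`IsClaimModel.exists_real_surplusSup`).

*Heavy tail.* Comparing `P(X₁ + X₂ > u) ∼ 2 P(X > u)` with an elementary lower bound for the left
side gives `P(X > u - a) ∼ P(X > u)` for fixed `a`
(`IsSubexponential.tendsto_tail_sub_div`). Iterating this, `P(X > u - y) / P(X > u)` is at most
`K e^(κy)` for large `u` and all `y ≥ 0` (`IsSubexponential.exists_tail_sub_le`). This bound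
shows that `e^(-κu)` is negligible and provides the dominating function for passing to the limit in
`∫ P(Cᵉ > u - y) / P(Cᵉ > u) d(law of M₀ + M₁)(y)`
(`IsSubexponential.tendsto_integral_tail_sub_div`).
-/

/-! ### Transition matrices of finite Markov jump processes -/

section MatrixExponential

variable {E : Type*} [Fintype E] [DecidableEq E]

open scoped Matrix.Norms.Operator in
theorem hasSum_matrix_exp (A : Matrix E E ℝ) :
    HasSum (fun n : ℕ => (n.factorial⁻¹ : ℝ) • A ^ n) (NormedSpace.exp A) :=
  NormedSpace.exp_series_hasSum_exp' (𝕂 := ℝ) A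

theorem matrix_exp_mulVec_of_mulVec_eq_zero {A : Matrix E E ℝ} {v : E → ℝ}
    (h : A.mulVec v = 0) : (NormedSpace.exp A).mulVec v = v := by
  have h1 := (hasSum_matrix_exp A).map (Matrix.mulVecBilin ℝ ℝ |>.flip v)
    (by
      change Continuous fun M : Matrix E E ℝ => M.mulVec v
      fun_prop)
  refine h1.unique ?_
  convert hasSum_single (0 : ℕ) ?_ using 1
  · simp
  · intro n hn
    obtain ⟨k, rfl⟩ := Nat.exists_eq_succ_of_ne_zero hn
    simp [pow_succ, h]

theorem matrix_exp_nonneg_of_nonneg {A : Matrix E E ℝ} (h : ∀ i j, 0 ≤ A i j) (i j : E) :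
    0 ≤ NormedSpace.exp A i j := by
  have h1 := (hasSum_matrix_exp A).map
    (Matrix.entryAddMonoidHom ℝ i j) (continuous_id.matrix_elem i j)
  have hp : ∀ (n : ℕ) (i j : E), 0 ≤ (A ^ n) i j := by
    intro n
    induction n with
    | zero => intro i j; simp only [pow_zero, Matrix.one_apply]; split_ifs <;> norm_num
    | succ n ih =>
      intro i j
      rw [pow_succ, Matrix.mul_apply]
      exact Finset.sum_nonneg fun k _ => mul_nonneg (ih i k) (h k j)
  refine h1.nonneg fun n => ?_
  have := hp n i j
  simp only [Function.comp_apply, Matrix.entryAddMonoidHom_apply, Matrix.smul_apply, smul_eq_mul]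
  positivity

theorem transitionMatrix_add (Q : Matrix E E ℝ) (s t : ℝ) :
    transitionMatrix Q (s + t) = transitionMatrix Q s * transitionMatrix Q t := by
  unfold transitionMatrix
  rw [add_smul]
  exact Matrix.exp_add_of_commute _ _ (((Commute.refl Q).smul_left s).smul_right t)

/-- Uniformization: `Q + c` has nonnegative entries for large `c`, and
`exp (t Q) = exp (-t c) exp (t (Q + c))`. -/
theorem transitionMatrix_nonneg {Q : Matrix E E ℝ} (hQ : IsGenerator Q) {t : ℝ} (ht : 0 ≤ t)
    (i j : E) : 0 ≤ transitionMatrix Q t i j := by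
  set c : ℝ := ∑ i, |Q i i| with hc
  have hsplit : t • Q = t • (Q + c • (1 : Matrix E E ℝ)) + (-(t * c)) • (1 : Matrix E E ℝ) := by
    rw [smul_add, smul_smul, neg_smul, add_neg_cancel_right]
  have hnn : ∀ i j, 0 ≤ (t • (Q + c • (1 : Matrix E E ℝ))) i j := by
    intro i j
    rw [Matrix.smul_apply, smul_eq_mul]
    refine mul_nonneg ht ?_
    by_cases hij : i = j
    · subst hij
      have : |Q i i| ≤ c :=
        Finset.single_le_sum (f := fun i => |Q i i|) (fun _ _ => abs_nonneg _) (Finset.mem_univ i)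
      have := neg_abs_le (Q i i)
      simp
      linarith
    · simpa [Matrix.one_apply, hij] using hQ.1 i j hij
  have hexp : NormedSpace.exp ((-(t * c)) • (1 : Matrix E E ℝ))
      = Real.exp (-(t * c)) • (1 : Matrix E E ℝ) := by
    have : (-(t * c)) • (1 : Matrix E E ℝ) = Matrix.diagonal fun _ => -(t * c) := by
      rw [Matrix.smul_one_eq_diagonal]
    rw [this, Matrix.exp_diagonal, Matrix.smul_one_eq_diagonal]
    congr 1
    ext i
    rw [Pi.coe_exp, Real.exp_eq_exp_ℝ]
  unfold transitionMatrix
  rw [hsplit, Matrix.exp_add_of_commute _ _ ((Commute.one_right _).smul_right _), hexp]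
  rw [Matrix.mul_smul, Matrix.mul_one, Matrix.smul_apply, smul_eq_mul]
  exact mul_nonneg (Real.exp_pos _).le (matrix_exp_nonneg_of_nonneg hnn i j)

theorem sum_transitionMatrix {Q : Matrix E E ℝ} (hQ : IsGenerator Q) (t : ℝ) (i : E) :
    ∑ j, transitionMatrix Q t i j = 1 := by
  have h : (t • Q).mulVec (fun _ => 1) = 0 := by
    ext i
    simp [Matrix.mulVec, dotProduct, ← Finset.mul_sum, hQ.2 i]
  have := congrFun (matrix_exp_mulVec_of_mulVec_eq_zero h) i
  simpa [Matrix.mulVec, dotProduct, transitionMatrix] using this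

theorem transitionMatrix_absorbing {Q : Matrix E E ℝ} {a : E} (ha : ∀ j, Q a j = 0) (t : ℝ) :
    transitionMatrix Q t a a = 1 := by
  have h : (t • Q).transpose.mulVec (Pi.single a 1) = 0 := by
    ext j
    simp [ha]
  have := congrFun (matrix_exp_mulVec_of_mulVec_eq_zero h) a
  rw [Matrix.exp_transpose] at this
  simpa [transitionMatrix] using this

/-- If absorption in `a` by time `T` has probability at least `1 / 2` from every state, the
probability of not being absorbed halves over every period of length `T`. -/
theorem survival_add_le {Q : Matrix E E ℝ} (hQ : IsGenerator Q) {a : E} (ha : ∀ j, Q a j = 0)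
    {T : ℝ} (hT : ∀ i, 1 / 2 ≤ transitionMatrix Q T i a) {t : ℝ} (ht : 0 ≤ t) (i : E) :
    1 - transitionMatrix Q (t + T) i a ≤ (1 - transitionMatrix Q t i a) / 2 := by
  have h1 : 1 - transitionMatrix Q (t + T) i a
      = ∑ j, transitionMatrix Q t i j * (1 - transitionMatrix Q T j a) := by
    rw [transitionMatrix_add, Matrix.mul_apply]
    simp only [mul_sub, mul_one, Finset.sum_sub_distrib, sum_transitionMatrix hQ]
  have h2 : (1 - transitionMatrix Q t i a) / 2
      = ∑ j, transitionMatrix Q t i j * (if j = a then 0 else 1 / 2) := by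
    have : ∀ j, transitionMatrix Q t i j * (if j = a then 0 else 1 / 2)
        = transitionMatrix Q t i j / 2 - if j = a then transitionMatrix Q t i j / 2 else 0 := by
      intro j
      split_ifs <;> ring
    simp only [this, Finset.sum_sub_distrib, Finset.sum_ite_eq', Finset.mem_univ, if_true,
      ← Finset.sum_div, sum_transitionMatrix hQ]
    ring
  rw [h1, h2]
  refine Finset.sum_le_sum fun j _ => mul_le_mul_of_nonneg_left ?_ (transitionMatrix_nonneg hQ ht i j)
  split_ifs with hj
  · rw [hj, transitionMatrix_absorbing ha, sub_self]
  · linarith [hT j]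

end MatrixExponential

/-! ### Exponential moments of phase-type distributions -/

/-- The tail of a phase-type distribution decays geometrically. -/
theorem IsPhaseType.exists_tail_le {μ : Measure ℝ} (h : IsPhaseType μ) :
    ∃ T : ℝ, 0 < T ∧ ∀ n : ℕ, μ (Ioi (n * T)) ≤ ENNReal.ofReal ((1 / 2) ^ n) := by
  obtain ⟨hP, -, n, α, Q, hα, hα1, hQ, habs, htrans, hcdf⟩ := h
  have hev : ∀ᶠ T : ℝ in atTop, ∀ i, 1 / 2 ≤ transitionMatrix Q T i none :=
    eventually_all.2 fun i => (htrans i).eventually_const_le (by norm_num)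
  obtain ⟨T, hT, hT0⟩ := (hev.and (eventually_gt_atTop 0)).exists
  refine ⟨T, hT0, fun k => ?_⟩
  have hsurv : ∀ k : ℕ, ∀ i, 1 - transitionMatrix Q (k * T) i none ≤ (1 / 2) ^ k := by
    intro k
    induction k with
    | zero =>
      intro i
      have := transitionMatrix_nonneg hQ le_rfl i none
      simpa using this
    | succ k ih =>
      intro i
      have h1 := survival_add_le hQ habs hT (t := k * T) (by positivity) i
      have h2 := ih i
      rw [Nat.cast_succ, add_one_mul, pow_succ]
      linarith
  have h1 : μ.real (Ioi (k * T)) ≤ (1 / 2) ^ k := by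
    rw [← compl_Iic, probReal_compl_eq_one_sub measurableSet_Iic, hcdf _ (by positivity)]
    calc 1 - ∑ i, α i * transitionMatrix Q (k * T) i none
        = ∑ i, α i * (1 - transitionMatrix Q (k * T) i none) := by
          simp only [mul_sub, mul_one, Finset.sum_sub_distrib, hα1]
      _ ≤ ∑ i, α i * (1 / 2) ^ k :=
          Finset.sum_le_sum fun i _ => mul_le_mul_of_nonneg_left (hsurv k i) (hα i)
      _ = (1 / 2) ^ k := by rw [← Finset.sum_mul, hα1, one_mul]
  rw [← ofReal_measureReal]
  exact ENNReal.ofReal_le_ofReal h1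

theorem IsPhaseType.exists_integrable_exp {μ : Measure ℝ} (h : IsPhaseType μ) :
    ∃ κ : ℝ, 0 < κ ∧ Integrable (fun x => Real.exp (κ * x)) μ := by
  obtain ⟨T, hT, htail⟩ := h.exists_tail_le
  have hP := h.1
  set κ : ℝ := Real.log (3 / 2) / T with hκ
  have hκ0 : 0 < κ := div_pos (Real.log_pos (by norm_num)) hT
  have hκT : ∀ n : ℕ, Real.exp (κ * (n * T)) = (3 / 2) ^ n := by
    intro n
    have : κ * (n * T) = n * Real.log (3 / 2) := by rw [hκ]; field_simp
    rw [this, Real.exp_nat_mul, Real.exp_log (by norm_num)]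
  refine ⟨κ, hκ0, (by fun_prop : Measurable fun x : ℝ => Real.exp (κ * x)).aestronglyMeasurable, ?_⟩
  rw [hasFiniteIntegral_iff_ofReal (ae_of_all _ fun x => (Real.exp_pos _).le)]
  -- a point `x` with `n T < x ≤ (n + 1) T` is charged to the `n`-th term
  have hpt : ∀ x : ℝ, ENNReal.ofReal (Real.exp (κ * x)) ≤
      1 + ∑' n : ℕ, (Ioi ((n : ℝ) * T)).indicator
        (fun _ => ENNReal.ofReal ((3 / 2) ^ (n + 1))) x := by
    intro x
    rcases le_or_gt x 0 with hx | hx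
    · refine le_trans ?_ le_self_add
      rw [← ENNReal.ofReal_one]
      exact ENNReal.ofReal_le_ofReal (Real.exp_le_one_iff.2 (mul_nonpos_of_nonneg_of_nonpos hκ0.le hx))
    · refine le_trans ?_ le_add_self
      obtain ⟨n, hn⟩ : ∃ n : ℕ, ⌈x / T⌉₊ = n + 1 :=
        Nat.exists_eq_succ_of_ne_zero (Nat.ceil_pos.2 (by positivity)).ne'
      have hn1 : (n : ℝ) * T < x := by
        rw [← lt_div_iff₀ hT]
        exact Nat.lt_ceil.1 (by omega)
      have hn2 : x ≤ (n + 1 : ℕ) * T := by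
        rw [← div_le_iff₀ hT, ← hn]
        exact Nat.le_ceil _
      refine le_trans ?_ (ENNReal.le_tsum n)
      rw [indicator_of_mem (mem_Ioi.2 hn1), ← hκT]
      gcongr
  refine (lintegral_mono hpt).trans_lt ?_
  rw [lintegral_add_left measurable_const, lintegral_tsum
    fun n => (measurable_const.indicator measurableSet_Ioi).aemeasurable]
  simp only [lintegral_const, measure_univ, mul_one,
    lintegral_indicator_const measurableSet_Ioi]
  refine ENNReal.add_lt_top.2 ⟨ENNReal.one_lt_top, ?_⟩
  have hsum : Summable fun n : ℕ => (3 / 2 : ℝ) * (3 / 4) ^ n :=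
    (summable_geometric_of_lt_one (by norm_num) (by norm_num)).mul_left _
  refine lt_of_le_of_lt (ENNReal.tsum_le_tsum fun n => ?_) hsum.tsum_ofReal_lt_top
  calc _ ≤ ENNReal.ofReal ((3 / 2) ^ (n + 1)) * ENNReal.ofReal ((1 / 2) ^ n) := by
        gcongr
        exact htail n
    _ = _ := by
        rw [← ENNReal.ofReal_mul (by positivity)]
        congr 1
        rw [pow_succ, mul_right_comm, ← mul_pow]
        norm_num [mul_comm]

/-! ### The supremum of the claim surplus has an exponential moment -/

theorem ae_nonneg_of_measure_Iio {μ : Measure ℝ} (h : μ (Iio 0) = 0) : ∀ᵐ x ∂μ, 0 ≤ x := by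
  rw [ae_iff]
  simpa only [not_le] using! h

/-- A version of the Lundberg inequality `lam * (E e^(κB) - 1) < κ`: both sides vanish at `κ = 0`,
and the derivatives there are `lam * mean B < 1` and `1`. -/
theorem exists_lundberg_exponent {μ : Measure ℝ} [IsProbabilityMeasure μ] (h0 : μ (Iio 0) = 0)
    (hexp : ∃ κ : ℝ, 0 < κ ∧ Integrable (fun x => Real.exp (κ * x)) μ) {lam : ℝ}
    (hlam : lam * mean μ < 1) :
    ∃ κ : ℝ, 0 < κ ∧ Integrable (fun x => Real.exp (κ * x)) μ ∧ lam * (mgf id μ κ - 1) < κ := by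
  obtain ⟨κ₀, hκ₀, hint⟩ := hexp
  have hsub : Iic κ₀ ⊆ integrableExpSet id μ := by
    intro κ hκ
    refine hint.mono' (by fun_prop) ?_
    filter_upwards [ae_nonneg_of_measure_Iio h0] with x hx
    rw [Real.norm_eq_abs, Real.abs_exp]
    exact Real.exp_le_exp.2 (mul_le_mul_of_nonneg_right hκ hx)
  have hmem : (0 : ℝ) ∈ interior (integrableExpSet id μ) :=
    mem_interior_iff_mem_nhds.2 (mem_of_superset (Iic_mem_nhds hκ₀) hsub)
  have hd : HasDerivAt (mgf id μ) (mean μ) 0 := by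
    simpa [mean] using hasDerivAt_mgf hmem
  have hf : HasDerivAt (fun κ => κ - lam * (mgf id μ κ - 1)) (1 - lam * mean μ) 0 :=
    (hasDerivAt_id 0).sub ((hd.sub_const 1).const_mul lam)
  have hslope := (hasDerivAt_iff_tendsto_slope.1 hf).eventually_const_lt (sub_pos.2 hlam)
  have hslope' := hslope.filter_mono (nhdsWithin_mono _ fun x (hx : x ∈ Ioi (0 : ℝ)) => ne_of_gt hx)
  obtain ⟨κ, hκ, hκ0, hκ1⟩ := (hslope'.and (Ioo_mem_nhdsGT hκ₀)).exists
  refine ⟨κ, hκ0, hsub hκ1.le, ?_⟩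
  rw [slope_def_field] at hκ
  simp only [mgf_zero', sub_zero, probReal_univ, sub_self, mul_zero] at hκ
  have := (div_pos_iff_of_pos_right hκ0).1 hκ
  linarith

section ClaimModel

variable {Ω : Type*} [MeasurableSpace Ω] {P : Measure Ω}
  {lam : ℝ≥0} {G : Measure ℝ} {N : ℝ≥0 → Ω → ℕ} {U : ℕ → Ω → ℝ}

theorem IsClaimModel.hasLaw_count (h : IsClaimModel P lam G N U) (t : ℝ≥0) :
    HasLaw (N t) (poissonMeasure (lam * t)) P := by
  have := h.poisson.law_increment 0 t zero_le
  simpa [h.poisson.zero] using this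

/-- The moment generating function of the compound Poisson sum. -/
theorem IsClaimModel.lintegral_exp_claims [IsProbabilityMeasure P]
    (h : IsClaimModel P lam G N U) {κ : ℝ}
    (hint : Integrable (fun x => Real.exp (κ * x)) G) (t : ℝ≥0) :
    ∫⁻ ω, ENNReal.ofReal (Real.exp (κ * ∑ i ∈ Finset.range (N t ω), U i ω)) ∂P
      = ENNReal.ofReal (Real.exp (lam * t * (mgf id G κ - 1))) := by
  have hsum_meas : ∀ n : ℕ, Measurable fun u : ℕ → ℝ =>
      ENNReal.ofReal (Real.exp (κ * ∑ i ∈ Finset.range n, u i)) := fun n => by fun_prop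
  have hU : Measurable fun ω i => U i ω := measurable_pi_lambda _ h.claim_measurable
  have hone : ∀ n : ℕ, Measurable (({n} : Set ℕ).indicator fun _ => (1 : ENNReal)) :=
    fun n => measurable_const.indicator (measurableSet_singleton n)
  have hdecomp : ∀ ω, ENNReal.ofReal (Real.exp (κ * ∑ i ∈ Finset.range (N t ω), U i ω))
      = ∑' n : ℕ, (({n} : Set ℕ).indicator (fun _ => (1 : ENNReal)) (N t ω)) *
          ENNReal.ofReal (Real.exp (κ * ∑ i ∈ Finset.range n, U i ω)) := by
    intro ω
    rw [tsum_eq_single (N t ω)]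
    · simp
    · intro n hn
      simp [Ne.symm hn]
  have hmgf : ∀ i, mgf (U i) P κ = mgf id G κ := by
    intro i
    rw [← (h.claim_law i).map_eq, mgf_id_map (h.claim_measurable i).aemeasurable]
  have hterm : ∀ n : ℕ, ∫⁻ ω, (({n} : Set ℕ).indicator (fun _ => (1 : ENNReal)) (N t ω)) *
          ENNReal.ofReal (Real.exp (κ * ∑ i ∈ Finset.range n, U i ω)) ∂P
      = ENNReal.ofReal (Real.exp (-(lam * t)) * ((lam * t * mgf id G κ) ^ n / n.factorial)) := by
    intro n
    have hind : IndepFun (fun ω => ({n} : Set ℕ).indicator (fun _ => (1 : ENNReal)) (N t ω))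
        (fun ω => ENNReal.ofReal (Real.exp (κ * ∑ i ∈ Finset.range n, U i ω))) P :=
      h.indep.comp (φ := fun f : ℝ≥0 → ℕ => ({n} : Set ℕ).indicator (fun _ => (1 : ENNReal)) (f t))
        ((hone n).comp (measurable_pi_apply t)) (hsum_meas n)
    have hmul := lintegral_mul_eq_lintegral_mul_lintegral_of_indepFun
      ((hone n).comp (h.poisson.measurable t)) ((hsum_meas n).comp hU) hind
    have hN : ∫⁻ ω, ({n} : Set ℕ).indicator (fun _ => (1 : ENNReal)) (N t ω) ∂P
        = ENNReal.ofReal (Real.exp (-(lam * t)) * (lam * t) ^ n / n.factorial) := by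
      rw [← lintegral_map (hone n) (h.poisson.measurable t), (h.hasLaw_count t).map_eq,
        lintegral_indicator_const (measurableSet_singleton n), poissonMeasure_singleton, one_mul]
      simp
    have hS : ∫⁻ ω, ENNReal.ofReal (Real.exp (κ * ∑ i ∈ Finset.range n, U i ω)) ∂P
        = ENNReal.ofReal (mgf id G κ ^ n) := by
      have hI : Integrable (fun ω => Real.exp (κ * (∑ i ∈ Finset.range n, U i) ω)) P := by
        refine h.claim_indep.integrable_exp_mul_sum h.claim_measurable fun i _ => ?_
        have hmap := (h.claim_law i).map_eq
        rw [← hmap] at hint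
        exact hint.comp_measurable (h.claim_measurable i)
      have hm := h.claim_indep.mgf_sum (t := κ) h.claim_measurable (Finset.range n)
      simp only [hmgf, Finset.prod_const, Finset.card_range] at hm
      rw [← hm, mgf, ofReal_integral_eq_lintegral_ofReal hI (ae_of_all _ fun _ => (Real.exp_pos _).le)]
      simp only [Finset.sum_apply]
    refine hmul.trans ?_
    change (∫⁻ ω, ({n} : Set ℕ).indicator (fun _ => (1 : ENNReal)) (N t ω) ∂P) *
      (∫⁻ ω, ENNReal.ofReal (Real.exp (κ * ∑ i ∈ Finset.range n, U i ω)) ∂P) = _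
    rw [hN, hS, ← ENNReal.ofReal_mul (by positivity)]
    congr 1
    rw [mul_pow]
    ring
  simp_rw [hdecomp]
  have hterm_meas : ∀ n : ℕ, AEMeasurable (fun ω =>
      (({n} : Set ℕ).indicator (fun _ => (1 : ENNReal)) (N t ω)) *
        ENNReal.ofReal (Real.exp (κ * ∑ i ∈ Finset.range n, U i ω))) P := fun n =>
    (((hone n).comp (h.poisson.measurable t)).mul ((hsum_meas n).comp hU)).aemeasurable
  rw [lintegral_tsum hterm_meas]
  simp_rw [hterm]
  have hφ : 0 ≤ mgf id G κ := mgf_nonneg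
  have hs : HasSum (fun n : ℕ => Real.exp (-(lam * t)) * ((lam * t * mgf id G κ) ^ n / n.factorial))
      (Real.exp (-(lam * t)) * Real.exp (lam * t * mgf id G κ)) :=
    HasSum.mul_left (f := fun n : ℕ => (lam * t * mgf id G κ) ^ n / n.factorial) _
      (by rw [Real.exp_eq_exp_ℝ]; exact NormedSpace.expSeries_div_hasSum_exp _)
  rw [← ENNReal.ofReal_tsum_of_nonneg (fun n => by positivity) hs.summable, hs.tsum_eq,
    ← Real.exp_add]
  congr 2
  ring

theorem IsClaimModel.measurable_claimSurplus (h : IsClaimModel P lam G N U) (t : ℝ≥0) :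
    Measurable (claimSurplus N U t) := by
  have h1 : Measurable fun p : ℕ × Ω => ∑ i ∈ Finset.range p.1, U i p.2 :=
    measurable_from_prod_countable_right fun n =>
      Finset.measurable_fun_sum (Finset.range n) fun i _ => h.claim_measurable i
  exact (h1.comp ((h.poisson.measurable t).prodMk measurable_id)).sub_const _

/-- Right-continuity of the paths reduces the supremum to a countable dense set of times. -/
theorem IsClaimModel.measurable_surplusSup (h : IsClaimModel P lam G N U) :
    Measurable (surplusSup N U) := by
  obtain ⟨D, hDc, hDd⟩ := TopologicalSpace.exists_countable_dense ℝ≥0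
  have heq : surplusSup N U = fun ω => ⨆ t ∈ D, (claimSurplus N U t ω : EReal) := by
    ext1 ω
    refine le_antisymm (iSup_le fun t => ?_) (iSup₂_le fun t _ => le_iSup
      (fun t : ℝ≥0 => (claimSurplus N U t ω : EReal)) t)
    refine le_of_forall_lt fun c hc => ?_
    have hcont : ContinuousWithinAt (fun s => (claimSurplus N U s ω : EReal)) (Ioi t) t := by
      refine continuous_coe_real_ereal.continuousAt.comp_continuousWithinAt ?_
      have h1 : ContinuousWithinAt (fun s => ∑ i ∈ Finset.range (N s ω), U i ω) (Ioi t) t :=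
        (continuous_of_discreteTopology (f := fun n : ℕ => ∑ i ∈ Finset.range n, U i ω)
          ).continuousAt.comp_continuousWithinAt (h.poisson.rightCts ω t)
      exact h1.sub NNReal.continuous_coe.continuousWithinAt
    have hev := hcont.eventually_const_lt hc
    obtain ⟨b, hb, hsub⟩ := mem_nhdsGT_iff_exists_Ioo_subset.1 hev
    obtain ⟨s, hsD, hs⟩ := hDd.exists_between hb
    exact lt_of_lt_of_le (hsub hs) (le_iSup₂ (f := fun s (_ : s ∈ D) =>
      (claimSurplus N U s ω : EReal)) s hsD)
  rw [heq]
  exact Measurable.biSup D hDc fun t _ => (h.measurable_claimSurplus t).coe_real_ereal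

/-- With nonnegative claims the surplus at `t ∈ [k, k + 1]` is at most the surplus at `k + 1` plus
`1`, so `exp (κ M)` is bounded by the sum of `exp (κ (S_{k+1} + 1))`. The expectations of these
terms form a convergent geometric series. -/
theorem IsClaimModel.exists_real_surplusSup [IsProbabilityMeasure P]
    (h : IsClaimModel P lam G N U) (h0 : G (Iio 0) = 0)
    {κ : ℝ} (hκ : 0 < κ) (hint : Integrable (fun x => Real.exp (κ * x)) G)
    (hlund : lam * (mgf id G κ - 1) < κ) :
    ∃ M : Ω → ℝ, Measurable M ∧ (∀ ω, 0 ≤ M ω) ∧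
      surplusSup N U =ᵐ[P] (fun ω => (M ω : EReal)) ∧
      Integrable (fun ω => Real.exp (κ * M ω)) P := by
  have hS0 : ∀ ω, (0 : EReal) ≤ surplusSup N U ω := by
    intro ω
    refine le_trans (le_of_eq ?_) (le_iSup (fun t : ℝ≥0 => (claimSurplus N U t ω : EReal)) 0)
    simp [claimSurplus, h.poisson.zero]
  set M : Ω → ℝ := fun ω => (surplusSup N U ω).toReal with hM
  have hMm : Measurable M := h.measurable_surplusSup.ereal_toReal
  set W : Ω → ENNReal := fun ω => ∑' k : ℕ,
    ENNReal.ofReal (Real.exp (κ * (claimSurplus N U (k + 1) ω + 1))) with hW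
  have hWterm : ∀ k : ℕ, Measurable fun ω =>
      ENNReal.ofReal (Real.exp (κ * (claimSurplus N U (k + 1) ω + 1))) := fun k => by
    have := h.measurable_claimSurplus (k + 1)
    fun_prop
  have hWint : ∫⁻ ω, W ω ∂P < ⊤ := by
    rw [hW, lintegral_tsum fun k => (hWterm k).aemeasurable]
    set q : ℝ := lam * (mgf id G κ - 1) - κ with hq
    have hq0 : q < 0 := by linarith
    have hterm : ∀ k : ℕ, ∫⁻ ω, ENNReal.ofReal (Real.exp (κ * (claimSurplus N U (k + 1) ω + 1))) ∂P
        = ENNReal.ofReal (Real.exp (κ + q) * Real.exp q ^ k) := by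
      intro k
      have : ∀ ω, ENNReal.ofReal (Real.exp (κ * (claimSurplus N U (k + 1) ω + 1)))
          = ENNReal.ofReal (Real.exp (-(κ * k))) *
            ENNReal.ofReal (Real.exp (κ * ∑ i ∈ Finset.range (N (k + 1) ω), U i ω)) := by
        intro ω
        rw [← ENNReal.ofReal_mul (Real.exp_pos _).le, ← Real.exp_add]
        congr 2
        simp only [claimSurplus, NNReal.coe_add, NNReal.coe_natCast, NNReal.coe_one]
        ring
      simp_rw [this]
      rw [lintegral_const_mul' _ _ ENNReal.ofReal_ne_top, h.lintegral_exp_claims hint,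
        ← ENNReal.ofReal_mul (Real.exp_pos _).le, ← Real.exp_add, ← Real.exp_nat_mul,
        ← Real.exp_add]
      congr 2
      simp only [NNReal.coe_add, NNReal.coe_natCast, NNReal.coe_one, hq]
      ring
    simp_rw [hterm]
    exact ((summable_geometric_of_lt_one (Real.exp_pos _).le
      (Real.exp_lt_one_iff.2 hq0)).mul_left _).tsum_ofReal_lt_top
  have hWm : Measurable W := Measurable.tsum hWterm
  have hWfin : ∀ᵐ ω ∂P, W ω < ⊤ := ae_lt_top hWm hWint.ne
  have hUnn : ∀ᵐ ω ∂P, ∀ i, 0 ≤ U i ω := by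
    refine ae_all_iff.2 fun i => ?_
    have := ae_nonneg_of_measure_Iio h0
    rw [← (h.claim_law i).map_eq] at this
    exact ae_of_ae_map (h.claim_measurable i).aemeasurable this
  have hkey : ∀ᵐ ω ∂P, surplusSup N U ω = (M ω : EReal) ∧
      Real.exp (κ * M ω) ≤ (W ω).toReal := by
    filter_upwards [hWfin, hUnn] with ω hω hu
    have hbound : ∀ t : ℝ≥0, Real.exp (κ * claimSurplus N U t ω) ≤ (W ω).toReal := by
      intro t
      set k := ⌊t⌋₊ with hk
      have hk1 : t ≤ k + 1 := (Nat.lt_floor_add_one t).le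
      have hk2 : (k : ℝ) ≤ t := by exact_mod_cast Nat.floor_le (zero_le : 0 ≤ t)
      have hle : claimSurplus N U t ω ≤ claimSurplus N U (k + 1) ω + 1 := by
        have hs : ∑ i ∈ Finset.range (N t ω), U i ω ≤ ∑ i ∈ Finset.range (N (k + 1) ω), U i ω :=
          Finset.sum_le_sum_of_subset_of_nonneg
            (Finset.range_mono (h.poisson.mono ω hk1)) fun i _ _ => hu i
        simp only [claimSurplus, NNReal.coe_add, NNReal.coe_natCast, NNReal.coe_one]
        linarith
      rw [← ENNReal.ofReal_le_iff_le_toReal hω.ne]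
      refine le_trans ?_ (ENNReal.le_tsum k)
      gcongr
    have hWpos : 0 < (W ω).toReal := (Real.exp_pos _).trans_le (hbound 0)
    have hsup : surplusSup N U ω ≤ ((Real.log (W ω).toReal / κ : ℝ) : EReal) := by
      refine iSup_le fun t => EReal.coe_le_coe_iff.2 ?_
      rw [le_div_iff₀' hκ]
      exact (Real.le_log_iff_exp_le hWpos).2 (hbound t)
    have hcoe : (M ω : EReal) = surplusSup N U ω :=
      EReal.coe_toReal (ne_top_of_le_ne_top (EReal.coe_ne_top _) hsup)
        (ne_bot_of_le_ne_bot EReal.zero_ne_bot (hS0 ω))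
    refine ⟨hcoe.symm, ?_⟩
    rw [← hcoe, EReal.coe_le_coe_iff, le_div_iff₀' hκ] at hsup
    exact (Real.le_log_iff_exp_le hWpos).1 hsup
  refine ⟨M, hMm, fun ω => EReal.toReal_nonneg (hS0 ω), hkey.mono fun ω hω => hω.1, ?_⟩
  exact (integrable_toReal_of_lintegral_ne_top hWm.aemeasurable hWint.ne).mono'
    (by fun_prop) (hkey.mono fun ω hω => by
      rw [Real.norm_eq_abs, Real.abs_exp]; exact hω.2)

end ClaimModel

/-! ### Subexponential distributions are long-tailed -/

theorem antitone_real_Ioi (μ : Measure ℝ) [IsFiniteMeasure μ] :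
    Antitone fun u : ℝ => μ.real (Ioi u) :=
  fun _ _ h => measureReal_mono (Ioi_subset_Ioi h)

theorem tendsto_real_Ioi_atTop (μ : Measure ℝ) [IsProbabilityMeasure μ] :
    Tendsto (fun u : ℝ => μ.real (Ioi u)) atTop (𝓝 0) := by
  have h : ∀ u : ℝ, μ.real (Ioi u) = 1 - cdf μ u := by
    intro u
    rw [cdf_eq_real, ← compl_Iic, probReal_compl_eq_one_sub measurableSet_Iic]
  simp_rw [h]
  simpa using (tendsto_cdf_atTop μ).const_sub 1

/-- If the tail vanished somewhere, the tail ratio for `n = 1` would eventually be the junk value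
`0 / 0 = 0` instead of tending to `1`. -/
theorem IsSubexponential.tail_pos {F : Measure ℝ} (h : IsSubexponential F) (u : ℝ) :
    0 < F.real (Ioi u) := by
  have := h.1
  by_contra hu
  have hu0 : F.real (Ioi u) = 0 := le_antisymm (not_lt.1 hu) measureReal_nonneg
  have hev : ∀ᶠ v : ℝ in atTop, (convPow F 1).real (Ioi v) / F.real (Ioi v) = 0 := by
    filter_upwards [eventually_ge_atTop u] with v hv
    have : F.real (Ioi v) = 0 :=
      le_antisymm ((antitone_real_Ioi F hv).trans hu0.le) measureReal_nonneg
    rw [this, div_zero]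
  have h1 := (tendsto_congr' hev).1 (h.2.2 1 le_rfl)
  have := tendsto_nhds_unique h1 tendsto_const_nhds
  norm_num at this

/-- A lower bound for the tail of `F ∗ F` from the disjoint events `{X > u}`, `{X ≤ a, Y > u}` and
`{a < X ≤ u, Y > u - a}`. -/
theorem real_conv_self_Ioi_ge {F : Measure ℝ} [IsProbabilityMeasure F] (h0 : F (Iio 0) = 0)
    {a u : ℝ} (ha : 0 ≤ a) (hau : a ≤ u) :
    F.real (Ioi u) + (1 - F.real (Ioi a)) * F.real (Ioi u)
      + (F.real (Ioi a) - F.real (Ioi u)) * F.real (Ioi (u - a))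
      ≤ (F.conv F).real (Ioi u) := by
  have hIci : F.real (Ici 0) = 1 := by
    rw [← compl_Iio, probReal_compl_eq_one_sub measurableSet_Iio, measureReal_def, h0]
    simp
  have hIcc : F.real (Icc 0 a) = 1 - F.real (Ioi a) := by
    have hd : Ici (0 : ℝ) = Icc 0 a ∪ Ioi a := (Icc_union_Ioi_eq_Ici ha).symm
    have := measureReal_union (μ := F) (s₁ := Icc 0 a) (s₂ := Ioi a)
      (disjoint_left.2 fun x hx hx' => not_lt.2 hx.2 hx') measurableSet_Ioi
    rw [← hd, hIci] at this
    linarith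
  have hIoc : F.real (Ioc a u) = F.real (Ioi a) - F.real (Ioi u) := by
    have hd : Ioi a = Ioc a u ∪ Ioi u := (Ioc_union_Ioi_eq_Ioi hau).symm
    have := measureReal_union (μ := F) (s₁ := Ioc a u) (s₂ := Ioi u)
      (disjoint_left.2 fun x hx hx' => not_lt.2 hx.2 hx') measurableSet_Ioi
    rw [← hd] at this
    linarith
  have hconv : (F.conv F).real (Ioi u) = (F.prod F).real {p : ℝ × ℝ | u < p.1 + p.2} := by
    rw [Measure.conv, map_measureReal_apply (by fun_prop) measurableSet_Ioi]
    rfl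
  rw [hconv, ← hIcc, ← hIoc]
  calc F.real (Ioi u) + F.real (Icc 0 a) * F.real (Ioi u) + F.real (Ioc a u) * F.real (Ioi (u - a))
      = (F.prod F).real (Ioi u ×ˢ Ici 0) + (F.prod F).real (Icc 0 a ×ˢ Ioi u)
          + (F.prod F).real (Ioc a u ×ˢ Ioi (u - a)) := by
        simp only [measureReal_prod_prod, hIci, mul_one]
    _ = (F.prod F).real (Ioi u ×ˢ Ici 0 ∪ Icc 0 a ×ˢ Ioi u ∪ Ioc a u ×ˢ Ioi (u - a)) := by
        rw [measureReal_union _ (measurableSet_Ioc.prod measurableSet_Ioi),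
          measureReal_union _ (measurableSet_Icc.prod measurableSet_Ioi)]
        · rw [disjoint_left]
          rintro ⟨x, y⟩ ⟨hx, -⟩ ⟨hx', -⟩
          exact absurd (mem_Ioi.1 hx) (not_lt.2 (hx'.2.trans hau))
        · rw [disjoint_left]
          rintro ⟨x, y⟩ (⟨hx, -⟩ | ⟨hx, -⟩) ⟨hx', -⟩
          · exact absurd (mem_Ioi.1 hx) (not_lt.2 hx'.2)
          · exact absurd hx'.1 (not_lt.2 hx.2)
    _ ≤ _ := by
        refine measureReal_mono ?_
        rintro ⟨x, y⟩ ((⟨hx, hy⟩ | ⟨hx, hy⟩) | ⟨hx, hy⟩)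
        · simp only [mem_Ioi, mem_Ici, mem_ofPred_eq] at *; linarith
        · simp only [mem_Ioi, mem_Icc, mem_ofPred_eq] at *; linarith
        · simp only [mem_Ioi, mem_Ioc, mem_ofPred_eq] at *; linarith

theorem IsSubexponential.tendsto_tail_sub_div {F : Measure ℝ} (h : IsSubexponential F) {a : ℝ}
    (ha : 0 ≤ a) :
    Tendsto (fun u : ℝ => F.real (Ioi (u - a)) / F.real (Ioi u)) atTop (𝓝 1) := by
  have := h.1
  have hpos := h.tail_pos
  have h2 : Tendsto (fun u : ℝ => (F.conv F).real (Ioi u) / F.real (Ioi u)) atTop (𝓝 2) := by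
    have := h.2.2 2 one_le_two
    simpa [convPow] using this
  have hlim : Tendsto (fun u : ℝ => ((F.conv F).real (Ioi u) / F.real (Ioi u)
      - 2 + F.real (Ioi a)) / (F.real (Ioi a) - F.real (Ioi u))) atTop (𝓝 1) := by
    have := ((h2.sub_const 2).add_const (F.real (Ioi a))).div
      ((tendsto_real_Ioi_atTop F).const_sub (F.real (Ioi a))) (by simpa using (hpos a).ne')
    simpa [div_self (hpos a).ne'] using! this
  refine tendsto_of_tendsto_of_tendsto_of_le_of_le' tendsto_const_nhds hlim ?_ ?_
  · refine Eventually.of_forall fun u => (one_le_div (hpos u)).2 (antitone_real_Ioi F ?_)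
    linarith
  · filter_upwards [eventually_ge_atTop a, (tendsto_real_Ioi_atTop F).eventually_lt_const (hpos a)]
      with u hu hlt
    rw [le_div_iff₀ (sub_pos.2 hlt)]
    have hge := real_conv_self_Ioi_ge h.2.1 ha hu
    have hp := hpos u
    have : F.real (Ioi (u - a)) / F.real (Ioi u) * (F.real (Ioi a) - F.real (Ioi u))
        ≤ ((F.conv F).real (Ioi u) - 2 * F.real (Ioi u) + F.real (Ioi a) * F.real (Ioi u))
          / F.real (Ioi u) := by
      rw [div_mul_eq_mul_div]
      gcongr
      linarith
    refine this.trans (le_of_eq ?_)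
    field_simp

/-- A Potter-type bound: a long tail decays more slowly than any exponential. -/
theorem IsSubexponential.exists_tail_sub_le {F : Measure ℝ} (h : IsSubexponential F) {κ : ℝ}
    (hκ : 0 < κ) :
    ∃ K u₀ : ℝ, ∀ u ≥ u₀, ∀ y ≥ 0,
      F.real (Ioi (u - y)) / F.real (Ioi u) ≤ K * Real.exp (κ * y) := by
  have := h.1
  have hpos := h.tail_pos
  have hanti := antitone_real_Ioi F
  have hev := (h.tendsto_tail_sub_div zero_le_one).eventually_le_const (Real.one_lt_exp_iff.2 hκ)
  obtain ⟨u₀, hu₀⟩ := eventually_atTop.1 hev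
  have hstep : ∀ n : ℕ, ∀ x ≥ u₀, F.real (Ioi x) ≤ Real.exp (κ * n) * F.real (Ioi (x + n)) := by
    intro n
    induction n with
    | zero => intro x _; simp
    | succ n ih =>
      intro x hx
      have h1 := hu₀ (x + n + 1) (by have := n.cast_nonneg (α := ℝ); linarith)
      rw [div_le_iff₀ (hpos _), add_sub_cancel_right] at h1
      calc F.real (Ioi x) ≤ Real.exp (κ * n) * F.real (Ioi (x + n)) := ih x hx
        _ ≤ Real.exp (κ * n) * (Real.exp κ * F.real (Ioi (x + n + 1))) := by gcongr
        _ = _ := by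
          rw [← mul_assoc, ← Real.exp_add, Nat.cast_succ, ← add_assoc]
          ring_nf
  have hlong : ∀ x ≥ u₀, ∀ y ≥ 0,
      F.real (Ioi x) ≤ Real.exp (κ * (y + 1)) * F.real (Ioi (x + y)) := by
    intro x hx y hy
    have hceil := (Nat.ceil_lt_add_one hy).le
    calc F.real (Ioi x) ≤ Real.exp (κ * ⌈y⌉₊) * F.real (Ioi (x + ⌈y⌉₊)) := hstep _ x hx
      _ ≤ Real.exp (κ * (y + 1)) * F.real (Ioi (x + y)) :=
        mul_le_mul (by gcongr) (hanti (by have := Nat.le_ceil y; linarith)) measureReal_nonneg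
          (Real.exp_pos _).le
  refine ⟨Real.exp κ / F.real (Ioi u₀), u₀, fun u hu y hy => ?_⟩
  rw [div_le_iff₀ (hpos u)]
  have h1 : F.real (Ioi (u - y)) * F.real (Ioi u₀) ≤ F.real (Ioi (max (u - y) u₀)) := by
    rcases le_total (u - y) u₀ with hle | hle
    · rw [max_eq_right hle]
      exact mul_le_of_le_one_left (hpos _).le measureReal_le_one
    · rw [max_eq_left hle]
      exact mul_le_of_le_one_right (hpos _).le measureReal_le_one
  have h2 := hlong (max (u - y) u₀) (le_max_right _ _) (u - max (u - y) u₀)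
    (sub_nonneg.2 (max_le (by linarith) hu))
  rw [add_sub_cancel] at h2
  have h3 : Real.exp (κ * (u - max (u - y) u₀ + 1)) ≤ Real.exp κ * Real.exp (κ * y) := by
    rw [← Real.exp_add]
    refine Real.exp_le_exp.2 ?_
    have : u - max (u - y) u₀ ≤ y := by have := le_max_left (u - y) u₀; linarith
    nlinarith
  have h4 : F.real (Ioi (u - y)) * F.real (Ioi u₀)
      ≤ Real.exp κ * Real.exp (κ * y) * F.real (Ioi u) :=
    h1.trans (h2.trans (mul_le_mul_of_nonneg_right h3 (hpos u).le))
  calc F.real (Ioi (u - y)) ≤ Real.exp κ * Real.exp (κ * y) * F.real (Ioi u) / F.real (Ioi u₀) :=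
        (le_div_iff₀ (hpos _)).2 h4
    _ = _ := by ring

theorem IsSubexponential.tendsto_exp_div_tail {F : Measure ℝ} (h : IsSubexponential F) {κ : ℝ}
    (hκ : 0 < κ) :
    Tendsto (fun u : ℝ => Real.exp (-(κ * u)) / F.real (Ioi u)) atTop (𝓝 0) := by
  have := h.1
  have hpos := h.tail_pos
  obtain ⟨K, u₀, hK⟩ := h.exists_tail_sub_le (half_pos hκ)
  have hlim : Tendsto (fun u : ℝ => K / F.real (Ioi 0) * Real.exp (-(κ / 2 * u))) atTop (𝓝 0) := by
    have : Tendsto (fun u : ℝ => Real.exp (-(κ / 2 * u))) atTop (𝓝 0) :=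
      Real.tendsto_exp_neg_atTop_nhds_zero.comp (tendsto_id.const_mul_atTop (half_pos hκ))
    simpa using this.const_mul (K / F.real (Ioi 0))
  refine squeeze_zero' (Eventually.of_forall fun u => div_nonneg (Real.exp_pos _).le
    (hpos u).le) ?_ hlim
  filter_upwards [eventually_ge_atTop u₀, eventually_ge_atTop 0] with u hu hu0
  have h1 := hK u hu u hu0
  rw [sub_self] at h1
  have h2 : (F.real (Ioi u))⁻¹ ≤ K * Real.exp (κ / 2 * u) / F.real (Ioi 0) := by
    rw [le_div_iff₀ (hpos 0)]
    rwa [mul_comm, ← div_eq_mul_inv]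
  calc Real.exp (-(κ * u)) / F.real (Ioi u)
      ≤ Real.exp (-(κ * u)) * (K * Real.exp (κ / 2 * u) / F.real (Ioi 0)) := by
        rw [div_eq_mul_inv]; gcongr
    _ = K / F.real (Ioi 0) * Real.exp (-(κ / 2 * u)) := by
        have : Real.exp (-(κ / 2 * u)) = Real.exp (-(κ * u)) * Real.exp (κ / 2 * u) := by
          rw [← Real.exp_add]; congr 1; ring
        rw [this]; ring

/-- Adding an independent nonnegative random variable `Y` with an exponential moment does not
change the asymptotics of a subexponential tail. -/
theorem IsSubexponential.tendsto_integral_tail_sub_div {F : Measure ℝ} (h : IsSubexponential F)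
    {Ω : Type*} [MeasurableSpace Ω] {P : Measure Ω} [IsProbabilityMeasure P] {Y : Ω → ℝ}
    (hY : Measurable Y) (hY0 : ∀ ω, 0 ≤ Y ω) {κ : ℝ} (hκ : 0 < κ)
    (hint : Integrable (fun ω => Real.exp (κ * Y ω)) P) :
    Tendsto (fun u : ℝ => (∫ ω, F.real (Ioi (u - Y ω)) ∂P) / F.real (Ioi u)) atTop (𝓝 1) := by
  have := h.1
  obtain ⟨K, u₀, hK⟩ := h.exists_tail_sub_le hκ
  have hlim := tendsto_integral_filter_of_dominated_convergence (μ := P) (l := atTop)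
    (F := fun (u : ℝ) ω => F.real (Ioi (u - Y ω)) / F.real (Ioi u)) (f := fun _ => (1 : ℝ))
    (fun ω => K * Real.exp (κ * Y ω))
    (Eventually.of_forall fun u => (((antitone_real_Ioi F).measurable.comp
      (measurable_const.sub hY)).div_const _).aestronglyMeasurable)
    (by
      filter_upwards [eventually_ge_atTop u₀] with u hu
      refine ae_of_all _ fun ω => ?_
      rw [Real.norm_eq_abs, abs_of_nonneg (by positivity)]
      exact hK u hu _ (hY0 ω))
    (hint.const_mul K)
    (ae_of_all _ fun ω => h.tendsto_tail_sub_div (hY0 ω))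
  simpa [integral_div] using hlim

/-! ### The stationary excess distribution of a light-tailed claim -/

theorem real_Ioi_le_exp {Ω : Type*} [MeasurableSpace Ω] {P : Measure Ω} [IsFiniteMeasure P]
    {X : Ω → ℝ} {κ : ℝ} (hκ : 0 ≤ κ) (hint : Integrable (fun ω => Real.exp (κ * X ω)) P) (u : ℝ) :
    P.real {ω | u < X ω} ≤ mgf X P κ * Real.exp (-(κ * u)) := by
  refine (measureReal_mono fun ω (hω : u < X ω) => hω.le).trans
    ((measure_ge_le_exp_mul_mgf u hκ hint).trans (le_of_eq ?_))
  rw [mul_comm, neg_mul]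

theorem stationaryExcess_Ioi_le {μ : Measure ℝ} [IsProbabilityMeasure μ] (hm : 0 < mean μ)
    {κ : ℝ} (hκ : 0 < κ) (hint : Integrable (fun x => Real.exp (κ * x)) μ) (v : ℝ) :
    stationaryExcess μ (Ioi v) ≤
      ENNReal.ofReal (mgf id μ κ / mean μ / κ * Real.exp (-(κ * v))) := by
  set A : ℝ := mgf id μ κ / mean μ with hA
  have hA0 : 0 ≤ A := div_nonneg mgf_nonneg hm.le
  have hI : IntegrableOn (fun t => A * Real.exp (-κ * t)) (Ioi v) :=
    (integrableOn_exp_mul_Ioi (neg_lt_zero.2 hκ) v).const_mul A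
  calc stationaryExcess μ (Ioi v)
      = ∫⁻ t in Ioi v, ENNReal.ofReal (μ.real (Ioi t) / mean μ) ∂(volume.restrict (Ici 0)) :=
        withDensity_apply _ measurableSet_Ioi
    _ ≤ ∫⁻ t in Ioi v, ENNReal.ofReal (μ.real (Ioi t) / mean μ) :=
        lintegral_mono' (Measure.restrict_mono_measure Measure.restrict_le_self _) le_rfl
    _ ≤ ∫⁻ t in Ioi v, ENNReal.ofReal (A * Real.exp (-κ * t)) := by
        refine lintegral_mono fun t => ENNReal.ofReal_le_ofReal ?_
        rw [hA, div_mul_eq_mul_div, neg_mul]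
        gcongr
        exact real_Ioi_le_exp (X := id) hκ.le hint t
    _ = ENNReal.ofReal (A / κ * Real.exp (-(κ * v))) := by
        rw [← ofReal_integral_eq_lintegral_ofReal hI (ae_of_all _ fun t => by positivity),
          integral_const_mul, integral_exp_mul_Ioi (neg_lt_zero.2 hκ)]
        congr 1
        rw [neg_mul]
        field_simp

theorem isFiniteMeasure_stationaryExcess {μ : Measure ℝ} [IsProbabilityMeasure μ]
    (hm : 0 < mean μ) {κ : ℝ} (hκ : 0 < κ) (hint : Integrable (fun x => Real.exp (κ * x)) μ) :
    IsFiniteMeasure (stationaryExcess μ) := by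
  refine ⟨?_⟩
  have hneg : stationaryExcess μ (Iic (-1)) = 0 := by
    rw [stationaryExcess, withDensity_apply _ measurableSet_Iic,
      Measure.restrict_restrict measurableSet_Iic]
    have : Iic (-1 : ℝ) ∩ Ici 0 = ∅ := by
      ext x; simp only [mem_inter_iff, mem_Iic, mem_Ici, mem_empty_iff_false]; constructor
      · rintro ⟨h1, h2⟩; linarith
      · exact False.elim
    simp [this]
  rw [← Iic_union_Ioi (a := (-1 : ℝ))]
  refine (measure_union_le _ _).trans_lt ?_
  rw [hneg, zero_add]
  exact (stationaryExcess_Ioi_le hm hκ hint _).trans_lt ENNReal.ofReal_lt_top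

/-! ### Asymptotics of the corrected replace approximation -/

theorem tailSum_map_coe {Ω : Type*} [MeasurableSpace Ω] {P : Measure Ω} [IsProbabilityMeasure P]
    {M : Ω → ℝ} (hM : Measurable M) (μ : Measure ℝ) [IsFiniteMeasure μ] (u : ℝ) :
    tailSum (P.map fun ω => (M ω : EReal)) μ u
      = ∫ z, μ.real (Ioi (u - (M z.1 + M z.2))) ∂(P.prod P) := by
  have hMc : Measurable fun ω => (M ω : EReal) := hM.coe_real_ereal
  have hset : MeasurableSet {x : EReal × EReal × ℝ | (u : EReal) < x.1 + x.2.1 + (x.2.2 : EReal)} :=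
    measurableSet_lt measurable_const (by fun_prop)
  have hset' : MeasurableSet {x : (Ω × Ω) × ℝ | u < M x.1.1 + M x.1.2 + x.2} :=
    measurableSet_lt measurable_const (by fun_prop)
  have h1 : (P.map fun ω => (M ω : EReal)).prod ((P.map fun ω => (M ω : EReal)).prod μ)
      = (P.prod (P.prod μ)).map (Prod.map (fun ω => (M ω : EReal))
          (Prod.map (fun ω => (M ω : EReal)) id)) := by
    conv_lhs => rw [← Measure.map_id (μ := μ)]
    rw [Measure.map_prod_map _ _ hMc measurable_id,
      Measure.map_prod_map _ _ hMc (hMc.prodMap measurable_id)]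
  rw [tailSum, measureReal_def, h1, Measure.map_apply
    (hMc.prodMap (hMc.prodMap measurable_id)) hset, ← Measure.prodAssoc_prod,
    Measure.map_apply (MeasurableEquiv.measurable _)
      ((hMc.prodMap (hMc.prodMap measurable_id)) hset)]
  have h2 : (MeasurableEquiv.prodAssoc : (Ω × Ω) × ℝ ≃ᵐ Ω × Ω × ℝ) ⁻¹'
      (Prod.map (fun ω => (M ω : EReal)) (Prod.map (fun ω => (M ω : EReal)) id) ⁻¹'
        {x : EReal × EReal × ℝ | (u : EReal) < x.1 + x.2.1 + (x.2.2 : EReal)})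
      = {x : (Ω × Ω) × ℝ | u < M x.1.1 + M x.1.2 + x.2} := by
    ext ⟨⟨x, y⟩, z⟩
    simp only [mem_preimage, mem_ofPred_eq, MeasurableEquiv.prodAssoc, MeasurableEquiv.coe_mk,
      Equiv.prodAssoc_apply, Prod.map_apply, id_eq]
    rw [← EReal.coe_add, ← EReal.coe_add, EReal.coe_lt_coe_iff]
  rw [h2, Measure.prod_apply hset']
  have h3 : ∀ z : Ω × Ω, Prod.mk z ⁻¹' {x : (Ω × Ω) × ℝ | u < M x.1.1 + M x.1.2 + x.2}
      = Ioi (u - (M z.1 + M z.2)) := by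
    intro z
    ext x
    simp only [mem_preimage, mem_ofPred_eq, mem_Ioi]
    constructor <;> intro h <;> linarith
  simp_rw [h3]
  have hmeas : Measurable fun z : Ω × Ω => μ (Ioi (u - (M z.1 + M z.2))) := by
    have := measurable_measure_prodMk_left (ν := μ) hset'
    simpa only [h3] using this
  exact (integral_toReal hmeas.aemeasurable (ae_of_all _ fun _ => measure_lt_top _ _)).symm

theorem theoremt {Ω : Type*} [MeasurableSpace Ω] (P : Measure Ω) [IsProbabilityMeasure P]
    (lam : ℝ≥0) (hlam : 0 < lam) (eps : ℝ) (heps : 0 < eps) (heps1 : eps ≤ 1)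
    (B C : Measure ℝ)
    (hB : IsPhaseType B) (hB_mean : 0 < mean B)
    (hC_prob : IsProbabilityMeasure C) (hC_nonneg : C (Iio 0) = 0)
    (hC_int : Integrable (fun x : ℝ => x) C) (hC_mean : 0 < mean C)
    (hδ : (lam : ℝ) * mean B < 1)
    (hCe : IsSubexponential (stationaryExcess C))
    (N : ℝ≥0 → Ω → ℕ) (U : ℕ → Ω → ℝ) (hNU : IsClaimModel P lam B N U) :
    Tendsto (fun u : ℝ =>
      correctedReplace lam eps B C (P.map (surplusSup N U)) u /
        (eps * (lam * mean C) / (1 - lam * mean B) * (stationaryExcess C).real (Ioi u)))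
      atTop (𝓝 1) := by
  have hBp := hB.1
  have hCp := hCe.1
  obtain ⟨κ, hκ, hBint, hlund⟩ := exists_lundberg_exponent hB.2.1 hB.exists_integrable_exp hδ
  obtain ⟨M, hM, hM0, hMae, hMint⟩ := hNU.exists_real_surplusSup hB.2.1 hκ hBint hlund
  have hBe := isFiniteMeasure_stationaryExcess hB_mean hκ hBint
  rw [Measure.map_congr hMae]
  have hYint : Integrable (fun z : Ω × Ω => Real.exp (κ * (M z.1 + M z.2))) (P.prod P) := by
    simp_rw [mul_add, Real.exp_add]
    exact hMint.mul_prod hMint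
  have hexp := hCe.tendsto_exp_div_tail hκ
  -- the phase-type tails are dominated by a multiple of `exp (-κ u)`
  have hlight : ∀ (f : ℝ → ℝ) (K : ℝ), (∀ u, 0 ≤ f u) →
      (∀ u, f u ≤ K * Real.exp (-(κ * u))) →
      Tendsto (fun u => f u / (stationaryExcess C).real (Ioi u)) atTop (𝓝 0) := by
    intro f K hf0 hf
    refine squeeze_zero (g := fun u => K * (Real.exp (-(κ * u)) /
      (stationaryExcess C).real (Ioi u))) (fun u => div_nonneg (hf0 u) measureReal_nonneg)
      (fun u => ?_) (by simpa using hexp.const_mul K)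
    rw [← mul_div_assoc]
    exact div_le_div_of_nonneg_right (hf u) measureReal_nonneg
  have hψ : Tendsto (fun u : ℝ => (P.map fun ω => (M ω : EReal)).real (Ioi (u : EReal)) /
      (stationaryExcess C).real (Ioi u)) atTop (𝓝 0) := by
    refine hlight _ (mgf M P κ) (fun u => measureReal_nonneg) fun u => ?_
    rw [map_measureReal_apply hM.coe_real_ereal measurableSet_Ioi]
    refine le_trans (le_of_eq ?_) (real_Ioi_le_exp hκ.le hMint u)
    congr 1
    ext ω
    simp
  have hTC : Tendsto (fun u : ℝ => tailSum (P.map fun ω => (M ω : EReal)) (stationaryExcess C) u /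
      (stationaryExcess C).real (Ioi u)) atTop (𝓝 1) := by
    simp_rw [tailSum_map_coe hM]
    exact hCe.tendsto_integral_tail_sub_div (by fun_prop)
      (fun z => add_nonneg (hM0 z.1) (hM0 z.2)) hκ hYint
  have hTB : Tendsto (fun u : ℝ => tailSum (P.map fun ω => (M ω : EReal)) (stationaryExcess B) u /
      (stationaryExcess C).real (Ioi u)) atTop (𝓝 0) := by
    refine hlight _ (mgf id B κ / mean B / κ * ∫ z, Real.exp (κ * (M z.1 + M z.2)) ∂(P.prod P))
      (fun u => measureReal_nonneg) fun u => ?_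
    have hK : 0 ≤ mgf id B κ / mean B / κ := by
      have : 0 ≤ mgf id B κ := mgf_nonneg
      positivity
    rw [tailSum_map_coe hM, mul_right_comm, ← integral_const_mul]
    refine integral_mono_of_nonneg (ae_of_all _ fun _ => measureReal_nonneg)
      (hYint.const_mul _) (ae_of_all _ fun z => ?_)
    refine (ENNReal.toReal_le_of_le_ofReal (by positivity)
      (stationaryExcess_Ioi_le hB_mean hκ hBint _)).trans (le_of_eq ?_)
    beta_reduce
    rw [mul_assoc, ← Real.exp_add]
    congr 2
    ring
  set a : ℝ := eps * (lam * mean C) / (1 - lam * mean B) with ha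
  have ha0 : 0 < a := by
    have : (0 : ℝ) < lam := hlam
    have : 0 < 1 - lam * mean B := sub_pos.2 hδ
    positivity
  set b : ℝ := eps * (lam * mean B) / (1 - lam * mean B) with hb
  have hlim := ((hψ.mul_const ((1 - a + b) / a)).add hTC).sub (hTB.mul_const (b / a))
  simp only [zero_mul, zero_add, sub_zero] at hlim
  refine hlim.congr fun u => ?_
  have hp := (hCe.tail_pos u).ne'
  simp only [correctedReplace, ← ha, ← hb]
  field_simp
  ring
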